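/- There is an absolute constant $C>0$ such that the following holds. Let $G=(V,E)$ be a finite simple $D$-regular graph with at least two vertices and $m=|E|$ edges, and let $\lambda$ be the second-largest eigenvalue, counted with multiplicity, of its adjacency matrix. Suppose that $\lambda\le D(1-c)$ for some $c>0$. Then for every integer $d\ge 1$ with $d<cD/2$ there is a collection $\mathcal T\subseteq 2^E$ such that 1. every $T\in\mathcal T$ is a connected-subgraph test: writing $N(T)$ for the set of endpoints of the edges in $T\subseteq E$, the graph $(N(T),T)$ is connected; 2. $\mathcal T$ is $d$-disjunct: for every $e\in E$ and every $B\subseteq E$ with $|B|\le d$ and $e\notin B$ there is $T\in\mathcal T$ with $e\in T$ and $B\cap T=\emptyset$; 3. $|\mathcal T|\le C\,d^2\log m$. -/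

import Mathlib

namespace GraphGroupTesting

/-- A family `𝒯` of subsets of the universe `E` is `d`-disjunct: for every item `e` and every set
`B` of at most `d` items with `e ∉ B`, some test contains `e` and misses `B`. -/
def IsDisjunct {α : Type*} (E : Finset α) (d : ℕ) (𝒯 : Finset (Finset α)) : Prop :=
  ∀ e ∈ E, ∀ B ⊆ E, B.card ≤ d → e ∉ B → ∃ T ∈ 𝒯, e ∈ T ∧ Disjoint B T

/-- `N(T)`: the vertices that are endpoints of an edge in `T`. -/
def endpoints {V : Type*} (T : Finset (Sym2 V)) : Set V :=
  {v | ∃ u, s(u, v) ∈ T}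

/-- A connected-subgraph test: a set `T` of edges of `G` such that the graph `(N(T), T)` is
connected. (A connected graph has a vertex, so a test is non-empty.) -/
def IsConnectedTest {V : Type*} (G : SimpleGraph V) (T : Finset (Sym2 V)) : Prop :=
  (T : Set (Sym2 V)) ⊆ G.edgeSet ∧
    ((SimpleGraph.fromEdgeSet (T : Set (Sym2 V))).induce (endpoints T)).Connected

theorem adjMatrix_isHermitian {V : Type*} (G : SimpleGraph V) [DecidableRel G.Adj] :
    (G.adjMatrix ℝ).IsHermitian := by
  rw [Matrix.IsHermitian, Matrix.conjTranspose_eq_transpose_of_trivial]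
  exact G.isSymm_adjMatrix

/-- The second-largest eigenvalue (with multiplicity) of the adjacency matrix of a graph with at
least two vertices; `eigenvalues₀` lists the eigenvalues in decreasing order from index `0`. -/
noncomputable def secondEigenvalue {V : Type*} [Fintype V] [DecidableEq V] (G : SimpleGraph V)
    [DecidableRel G.Adj] (hV : 2 ≤ Fintype.card V) : ℝ :=
  (adjMatrix_isHermitian G).eigenvalues₀ ⟨1, hV⟩

end GraphGroupTesting

/-! Keep each edge of `G` independently, deleting it with probability `q = x ^ 2`, where `x ^ d = 1
/ 2`, and test the edges of the component containing more than half of the vertices. There is at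
most one, so the test is connected and depends on the outcome alone, not on a pair `(e, B)`. For a
pair with `|B| = d`, the edge `e` is kept and `B` deleted with probability `(1 - q) * q ^ d = (1 -
q) / 4`. The spectral gap gives more than `d * |S|` boundary edges for every nonempty `S` with at
most half of the vertices, and deleting `B` costs at most `d` of them. Exploring the component of
`e` from its two endpoints, a supermartingale bounds the probability that it stays small by `2 * x ^
(2 * d) = 1 / 2` (`subsetProb_small_reachSet_le`). A random test thus serves the pair with
probability at least `(1 - q) / 8`, which is of order `1 / d`. There are at most `m ^ (d + 1)`
pairs, so greedy covering needs `O(d * d * log m)` tests. -/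

open Finset

namespace GraphGroupTesting

/-! ### Random subsets and greedy covering -/

section RandomSubset

variable {α : Type*} [DecidableEq α]

open Classical in
/-- The probability that a random subset of `U`, which misses each element independently with
probability `q`, satisfies `P`. -/
noncomputable def subsetProb (q : ℝ) (U : Finset α) (P : Finset α → Prop) : ℝ :=
  ∑ F ∈ U.powerset, if P F then (1 - q) ^ F.card * q ^ (U \ F).card else 0

theorem subsetProb_insert (q : ℝ) {U : Finset α} {f : α} (hf : f ∉ U) (P : Finset α → Prop) :
    subsetProb q (insert f U) P =
      (1 - q) * subsetProb q U (fun F => P (insert f F)) + q * subsetProb q U P := by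
  classical
  unfold subsetProb
  rw [Finset.sum_powerset_insert hf, add_comm, Finset.mul_sum, Finset.mul_sum]
  congr 1
  · refine Finset.sum_congr rfl fun F hF => ?_
    have hfF : f ∉ F := fun h => hf (Finset.mem_powerset.1 hF h)
    have h1 : insert f U \ insert f F = U \ F := by
      ext y; simp only [mem_sdiff, mem_insert]; grind
    split_ifs
    · rw [h1, Finset.card_insert_of_notMem hfF]; ring
    · simp
  · refine Finset.sum_congr rfl fun F hF => ?_
    have hfF : f ∉ F := fun h => hf (Finset.mem_powerset.1 hF h)
    have h1 : insert f U \ F = insert f (U \ F) := Finset.insert_sdiff_of_notMem _ hfF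
    split_ifs
    · rw [h1, Finset.card_insert_of_notMem (by simp [hf])]; ring
    · simp

theorem subsetProb_nonneg {q : ℝ} (h0 : 0 ≤ q) (h1 : q ≤ 1) (U : Finset α) (P : Finset α → Prop) :
    0 ≤ subsetProb q U P := by
  classical
  refine Finset.sum_nonneg fun F _ => ?_
  have : 0 ≤ 1 - q := by linarith
  split_ifs <;> positivity

theorem subsetProb_mono {q : ℝ} (h0 : 0 ≤ q) (h1 : q ≤ 1) (U : Finset α) {P Q : Finset α → Prop}
    (h : ∀ F ⊆ U, P F → Q F) : subsetProb q U P ≤ subsetProb q U Q := by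
  classical
  refine Finset.sum_le_sum fun F hF => ?_
  have : 0 ≤ 1 - q := by linarith
  have hPQ := h F (Finset.mem_powerset.1 hF)
  by_cases hP : P F
  · simp [hP, hPQ hP]
  · simp only [hP, if_false]; split_ifs <;> positivity

theorem subsetProb_add_not (q : ℝ) (U : Finset α) (P : Finset α → Prop) :
    subsetProb q U P + subsetProb q U (fun F => ¬ P F) = 1 := by
  classical
  induction U using Finset.induction_on generalizing P with
  | empty => by_cases h : P ∅ <;> simp [subsetProb, h]
  | insert f U hf ih =>
    rw [subsetProb_insert q hf, subsetProb_insert q hf]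
    have h1 := ih P
    have h2 := ih (fun F => P (insert f F))
    linear_combination (1 - q) * h2 + q * h1

theorem subsetProb_le_one {q : ℝ} (h0 : 0 ≤ q) (h1 : q ≤ 1) (U : Finset α) (P : Finset α → Prop) :
    subsetProb q U P ≤ 1 := by
  linarith [subsetProb_add_not q U P, subsetProb_nonneg h0 h1 U (fun F => ¬ P F)]

/-- The left side is the contribution of the outcomes that miss all of `B`. -/
theorem pow_card_mul_subsetProb_le {q : ℝ} (h0 : 0 ≤ q) (h1 : q ≤ 1) (U B : Finset α)
    (hB : Disjoint B U) (P : Finset α → Prop) :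
    q ^ B.card * subsetProb q U P ≤ subsetProb q (B ∪ U) P := by
  induction B using Finset.induction_on with
  | empty => simp
  | insert f B hf ih =>
    rw [Finset.disjoint_insert_left] at hB
    have hfU : f ∉ B ∪ U := by simp [hf, hB.1]
    rw [Finset.insert_union, subsetProb_insert q hfU, Finset.card_insert_of_notMem hf, pow_succ]
    have h2 := mul_le_mul_of_nonneg_left (ih hB.2) h0
    have h3 := mul_nonneg (sub_nonneg.2 h1)
      (subsetProb_nonneg h0 h1 (B ∪ U) (fun F => P (insert f F)))
    linarith

/-- The probability of an event on the outcomes that contain `e` and miss `B`. -/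
theorem conditioned_subsetProb_le {q : ℝ} (h0 : 0 ≤ q) (h1 : q ≤ 1) {E B : Finset α} {e : α}
    (he : e ∈ E) (hB : B ⊆ E) (heB : e ∉ B) (P : Finset α → Prop) :
    (1 - q) * (q ^ B.card *
      subsetProb q ((E \ B).erase e) (fun F => P (insert e F))) ≤ subsetProb q E P := by
  have hd : Disjoint B ((E \ B).erase e) := by
    rw [Finset.disjoint_left]; intro a; simp; tauto
  have hE : E = insert e (B ∪ (E \ B).erase e) := by
    ext a
    have := @hB a
    simp only [mem_insert, mem_union, mem_erase, mem_sdiff]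
    grind
  have hn : e ∉ B ∪ (E \ B).erase e := by simp [heB]
  conv_rhs => rw [hE, subsetProb_insert q hn]
  have h2 := mul_le_mul_of_nonneg_left (pow_card_mul_subsetProb_le h0 h1 _ B hd
    (fun F => P (insert e F))) (sub_nonneg.2 h1)
  have h3 := mul_nonneg h0 (subsetProb_nonneg h0 h1 (B ∪ (E \ B).erase e) P)
  linarith

open Classical in
/-- Greedy covering: if every constraint in `X` is met with probability at least `r`, then `N`
outcomes can be chosen that leave at most a `(1 - r) ^ N` fraction of `X` unmet. -/
theorem exists_greedy_cover {β : Type*} {q r : ℝ} (h0 : 0 ≤ q) (h1 : q ≤ 1) (hr : r ≤ 1)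
    (E : Finset α) (X : Finset β) (R : Finset α → β → Prop)
    (hR : ∀ x ∈ X, r ≤ subsetProb q E (fun F => R F x)) (N : ℕ) :
    ∃ 𝒜 : Finset (Finset α), 𝒜 ⊆ E.powerset ∧ 𝒜.card ≤ N ∧
      ((X.filter fun x => ∀ F ∈ 𝒜, ¬ R F x).card : ℝ) ≤ (1 - r) ^ N * X.card := by
  induction N with
  | zero => exact ⟨∅, by simp, by simp, by simp⟩
  | succ N ih =>
    obtain ⟨𝒜, h𝒜, hcard, hun⟩ := ih
    set Y := X.filter fun x => ∀ F ∈ 𝒜, ¬ R F x with hY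
    set w : Finset α → ℝ := fun F => (1 - q) ^ F.card * q ^ (E \ F).card with hw
    have hw0 : ∀ F, 0 ≤ w F := fun F => by
      have : 0 ≤ 1 - q := by linarith
      simp only [hw]; positivity
    have hw1 : ∑ F ∈ E.powerset, w F = 1 := by
      have := subsetProb_add_not q E (fun _ => True)
      simpa [subsetProb] using this
    -- Averaging: the expected number of constraints of `Y` met by a random outcome is at least `r *
    -- |Y|`.
    have key : ∃ F ∈ E.powerset, r * Y.card ≤ ((Y.filter fun x => R F x).card : ℝ) := by
      by_contra! hcon
      have hsum : r * Y.card ≤ ∑ F ∈ E.powerset, w F * ((Y.filter fun x => R F x).card : ℝ) := by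
        calc r * Y.card = ∑ x ∈ Y, r := by simp [mul_comm]
          _ ≤ ∑ x ∈ Y, subsetProb q E (fun F => R F x) :=
            Finset.sum_le_sum fun x hx => hR x (Finset.mem_filter.1 hx).1
          _ = _ := by
            unfold subsetProb
            rw [Finset.sum_comm]
            refine Finset.sum_congr rfl fun F _ => ?_
            rw [← Finset.sum_filter, Finset.sum_const, nsmul_eq_mul, mul_comm]
      have hlt : ∑ F ∈ E.powerset, w F * ((Y.filter fun x => R F x).card : ℝ)
          < ∑ F ∈ E.powerset, w F * (r * Y.card) := by
        obtain ⟨F, hF, hFw⟩ : ∃ F ∈ E.powerset, 0 < w F := by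
          by_contra! hc
          have := Finset.sum_nonpos hc
          linarith
        exact Finset.sum_lt_sum
          (fun F hF => mul_le_mul_of_nonneg_left (hcon F hF).le (hw0 F))
          ⟨F, hF, mul_lt_mul_of_pos_left (hcon F hF) hFw⟩
      rw [← Finset.sum_mul, hw1, one_mul] at hlt
      linarith
    obtain ⟨F, hF, hFY⟩ := key
    refine ⟨insert F 𝒜, Finset.insert_subset hF h𝒜,
      (Finset.card_insert_le _ _).trans (by omega), ?_⟩
    have hset : (X.filter fun x => ∀ F' ∈ insert F 𝒜, ¬ R F' x) = Y.filter fun x => ¬ R F x := by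
      ext x
      simp only [hY, mem_filter, Finset.forall_mem_insert]
      tauto
    have hsplit : ((Y.filter fun x => R F x).card : ℝ) + (Y.filter fun x => ¬ R F x).card
        = Y.card := by
      exact_mod_cast Finset.card_filter_add_card_filter_not (s := Y) (fun x => R F x)
    rw [hset, pow_succ]
    have := mul_le_mul_of_nonneg_left hun (sub_nonneg.2 hr)
    linarith

end RandomSubset

/-! ### Edge-by-edge exploration of a component -/

section Exploration

variable {V : Type*} [Fintype V] [DecidableEq V]

open Classical in
/-- The vertices joined to a vertex of `S` by a path with edges in `F`. -/
noncomputable def reachSet (F : Finset (Sym2 V)) (S : Finset V) : Finset V :=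
  univ.filter fun v => ∃ u ∈ S, (SimpleGraph.fromEdgeSet (F : Set (Sym2 V))).Reachable u v

open Classical in
/-- The edges in `H` between `S` and its complement. -/
noncomputable def boundary (H : Finset (Sym2 V)) (S : Finset V) : Finset (Sym2 V) :=
  H.filter fun f => ∃ a ∈ S, ∃ b ∉ S, f = s(a, b)

theorem mem_reachSet {F : Finset (Sym2 V)} {S : Finset V} {v : V} : v ∈ reachSet F S ↔
    ∃ u ∈ S, (SimpleGraph.fromEdgeSet (F : Set (Sym2 V))).Reachable u v := by
  simp [reachSet]

theorem subset_reachSet (F : Finset (Sym2 V)) (S : Finset V) : S ⊆ reachSet F S :=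
  fun v hv => mem_reachSet.2 ⟨v, hv, SimpleGraph.Reachable.refl _⟩

theorem reachSet_insert_vertex_subset (F : Finset (Sym2 V)) {S : Finset V} {a b : V}
    (ha : a ∈ S) (hab : a ≠ b) : reachSet F (insert b S) ⊆ reachSet (insert s(a, b) F) S := by
  intro v hv
  obtain ⟨u, hu, huv⟩ := mem_reachSet.1 hv
  have hle : SimpleGraph.fromEdgeSet (F : Set (Sym2 V)) ≤
      SimpleGraph.fromEdgeSet ((insert s(a, b) F : Finset (Sym2 V)) : Set (Sym2 V)) :=
    SimpleGraph.fromEdgeSet_mono (by simp)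
  have huv' := huv.mono hle
  rcases Finset.mem_insert.1 hu with rfl | hu
  · refine mem_reachSet.2 ⟨a, ha, SimpleGraph.Reachable.trans (SimpleGraph.Adj.reachable ?_) huv'⟩
    rw [SimpleGraph.fromEdgeSet_adj]
    exact ⟨by simp, hab⟩
  · exact mem_reachSet.2 ⟨u, hu, huv'⟩

/-- Exploring the component of `S` edge by edge, with the edges of `U` still unknown and those of
`Z` known to be absent, `x ^ (d * |S| - |Z|)` is a supermartingale. -/
theorem subsetProb_small_reachSet_le {x : ℝ} (hx0 : 0 < x) (hx1 : x ≤ 1) {d : ℕ}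
    (hxd : x ^ d = 1 / 2) (H : Finset (Sym2 V)) (S₀ : Finset V)
    (hH : ∀ S, S₀ ⊆ S → 2 * S.card ≤ Fintype.card V → d * S.card < (boundary H S).card + d)
    (U Z : Finset (Sym2 V)) (S : Finset V) (hS : S₀ ⊆ S)
    (hinv : ∀ f ∈ H, (∃ b ∈ f, b ∉ S) → f ∈ U ∪ Z) :
    subsetProb (x ^ 2) U (fun F => 2 * (reachSet F S).card ≤ Fintype.card V) * x ^ Z.card
      ≤ 2 * x ^ (d * S.card) := by
  have hq0 : 0 ≤ x ^ 2 := by positivity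
  have hq1 : x ^ 2 ≤ 1 := pow_le_one₀ hx0.le hx1
  induction hn : U.card using Nat.strong_induction_on generalizing U Z S with
  | _ n ih =>
  by_cases hbig : Fintype.card V < 2 * S.card
  · have hzero : subsetProb (x ^ 2) U
        (fun F => 2 * (reachSet F S).card ≤ Fintype.card V) = 0 := by
      refine Finset.sum_eq_zero fun F _ => if_neg fun h => ?_
      have := Finset.card_le_card (subset_reachSet F S)
      omega
    rw [hzero, zero_mul]; positivity
  push Not at hbig
  by_cases hbd : boundary H S ⊆ Z
  · have hcard := Finset.card_le_card hbd
    have hlt := hH S hS hbig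
    -- The exploration has stopped with the whole boundary absent, so `|Z| + d > d * |S|`. The
    -- factor `2 = x ^ (-d)` in the claim absorbs the slack `d`.
    have h1 : x ^ (Z.card + d) ≤ x ^ (d * S.card) := pow_le_pow_of_le_one hx0.le hx1 (by omega)
    rw [pow_add, hxd] at h1
    have h2 := mul_le_mul_of_nonneg_right (subsetProb_le_one hq0 hq1 U
      (fun F => 2 * (reachSet F S).card ≤ Fintype.card V)) (pow_nonneg hx0.le Z.card)
    linarith
  · obtain ⟨f, hf, hfZ⟩ := Finset.not_subset.1 hbd
    simp only [boundary, mem_filter] at hf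
    obtain ⟨hfH, a, ha, b, hb, rfl⟩ := hf
    have hfU : s(a, b) ∈ U := by
      have := hinv _ hfH ⟨b, by simp, hb⟩
      simpa [hfZ] using this
    have hUe : (U.erase s(a, b)).card < n := hn ▸ Finset.card_erase_lt_of_mem hfU
    have hab : a ≠ b := fun h => hb (h ▸ ha)
    -- If the revealed edge is present, it lies inside `insert b S` and need not be remembered; if
    -- absent, it moves to `Z`.
    have hopen := ih _ hUe (U.erase s(a, b)) Z (insert b S) (hS.trans (Finset.subset_insert _ _))
      (by
        rintro g hg ⟨c, hc, hcS⟩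
        have hg' := hinv g hg ⟨c, hc, fun h => hcS (Finset.mem_insert_of_mem h)⟩
        have : g ≠ s(a, b) := by
          rintro rfl
          rcases Sym2.mem_iff.1 hc with rfl | rfl
          · exact hcS (Finset.mem_insert_of_mem ha)
          · exact hcS (Finset.mem_insert_self _ _)
        simp only [mem_union, mem_erase] at hg' ⊢
        tauto) rfl
    have hclosed := ih _ hUe (U.erase s(a, b)) (insert s(a, b) Z) S hS
      (by
        rintro g hg hc
        have hg' := hinv g hg hc
        simp only [mem_union, mem_erase, mem_insert] at hg' ⊢
        tauto) rfl
    rw [Finset.card_insert_of_notMem hb, Nat.mul_succ, pow_add, hxd] at hopen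
    rw [Finset.card_insert_of_notMem hfZ, pow_succ] at hclosed
    have hmono := subsetProb_mono hq0 hq1 (U.erase s(a, b))
      (P := fun F => 2 * (reachSet (insert s(a, b) F) S).card ≤ Fintype.card V)
      (Q := fun F => 2 * (reachSet F (insert b S)).card ≤ Fintype.card V)
      (fun F _ h => by
        have := Finset.card_le_card (reachSet_insert_vertex_subset F ha hab)
        omega)
    have hins := subsetProb_insert (x ^ 2) (Finset.notMem_erase s(a, b) U)
      (fun F => 2 * (reachSet F S).card ≤ Fintype.card V)
    rw [Finset.insert_erase hfU] at hins
    rw [hins]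
    set p₁ := subsetProb (x ^ 2) (U.erase s(a, b))
      (fun F => 2 * (reachSet (insert s(a, b) F) S).card ≤ Fintype.card V)
    set p₂ := subsetProb (x ^ 2) (U.erase s(a, b))
      (fun F => 2 * (reachSet F (insert b S)).card ≤ Fintype.card V)
    set p₃ := subsetProb (x ^ 2) (U.erase s(a, b))
      (fun F => 2 * (reachSet F S).card ≤ Fintype.card V)
    set W := x ^ (d * S.card) with hW
    have hW0 : 0 ≤ W := by positivity
    have hZ0 : 0 ≤ x ^ Z.card := by positivity
    have e1 : (1 - x ^ 2) * (p₁ * x ^ Z.card) ≤ (1 - x ^ 2) * W :=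
      mul_le_mul_of_nonneg_left (by nlinarith) (by linarith)
    have e2 : x * (p₃ * (x ^ Z.card * x)) ≤ x * (2 * W) :=
      mul_le_mul_of_nonneg_left hclosed hx0.le
    -- An open edge halves `x ^ (d * |S|)`, a closed one divides by `x`; the expected factor is `(1
    -- - x ^ 2) / 2 + x = 1 - (1 - x) ^ 2 / 2 ≤ 1`.
    nlinarith [mul_nonneg hW0 (sq_nonneg (1 - x))]

end Exploration

/-! ### The component with more than half of the vertices -/

section LargeComponent

variable {V : Type*} [Fintype V] [DecidableEq V]

open Classical in
/-- The edges in `F` of a component with more than half of the vertices. -/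
noncomputable def largeComponent (F : Finset (Sym2 V)) : Finset (Sym2 V) :=
  F.filter fun e => ∃ u ∈ e, Fintype.card V < 2 * (reachSet F {u}).card

theorem reachSet_singleton_eq_of_reachable {F : Finset (Sym2 V)} {u v : V}
    (h : (SimpleGraph.fromEdgeSet (F : Set (Sym2 V))).Reachable u v) :
    reachSet F {u} = reachSet F {v} := by
  ext y
  simp only [mem_reachSet, mem_singleton, exists_eq_left]
  exact ⟨fun hy => h.symm.trans hy, fun hy => h.trans hy⟩

theorem largeComponent_subset (F : Finset (Sym2 V)) : largeComponent F ⊆ F :=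
  Finset.filter_subset _ _

theorem card_lt_of_mem_endpoints {F : Finset (Sym2 V)} {v : V}
    (hv : v ∈ endpoints (largeComponent F)) : Fintype.card V < 2 * (reachSet F {v}).card := by
  obtain ⟨u, hu⟩ := hv
  simp only [largeComponent, mem_filter] at hu
  obtain ⟨huF, w, hw, hcard⟩ := hu
  rcases Sym2.mem_iff.1 hw with rfl | rfl
  · by_cases h : w = v
    · rwa [← h]
    · rwa [← reachSet_singleton_eq_of_reachable (SimpleGraph.Adj.reachable _)]
      rw [SimpleGraph.fromEdgeSet_adj]
      exact ⟨huF, h⟩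
  · exact hcard

theorem induce_reachable_of_walk {F : Finset (Sym2 V)} {u v : V}
    (p : (SimpleGraph.fromEdgeSet (F : Set (Sym2 V))).Walk u v)
    (hu : u ∈ endpoints (largeComponent F)) (hv : v ∈ endpoints (largeComponent F)) :
    ((SimpleGraph.fromEdgeSet (largeComponent F : Set (Sym2 V))).induce
      (endpoints (largeComponent F))).Reachable ⟨u, hu⟩ ⟨v, hv⟩ := by
  induction p with
  | nil => exact SimpleGraph.Reachable.refl _
  | @cons u w v h p ih =>
    rw [SimpleGraph.fromEdgeSet_adj] at h
    have hmem : s(u, w) ∈ largeComponent F := by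
      simp only [largeComponent, mem_filter]
      exact ⟨h.1, u, by simp, card_lt_of_mem_endpoints hu⟩
    have hw : w ∈ endpoints (largeComponent F) := ⟨u, hmem⟩
    refine SimpleGraph.Reachable.trans (SimpleGraph.Adj.reachable ?_) (ih hw hv)
    simp only [SimpleGraph.comap_adj, SimpleGraph.fromEdgeSet_adj, Function.Embedding.subtype_apply]
    exact ⟨hmem, h.2⟩

/-- Two vertex sets, each with more than half of the vertices, intersect, so all the edges retained
lie in one component of `F`. -/
theorem isConnectedTest_largeComponent {G : SimpleGraph V} {F : Finset (Sym2 V)}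
    (hF : (F : Set (Sym2 V)) ⊆ G.edgeSet) (hne : (largeComponent F).Nonempty) :
    IsConnectedTest G (largeComponent F) := by
  refine ⟨fun e he => hF (largeComponent_subset F he), ?_⟩
  obtain ⟨e, he⟩ := hne
  induction e using Sym2.ind with
  | _ a b =>
  have : Nonempty (endpoints (largeComponent F)) := ⟨⟨b, a, he⟩⟩
  refine SimpleGraph.Connected.mk ?_
  rintro ⟨u, hu⟩ ⟨v, hv⟩
  have hu' := card_lt_of_mem_endpoints hu
  have hv' := card_lt_of_mem_endpoints hv
  obtain ⟨y, hy⟩ : (reachSet F {u} ∩ reachSet F {v}).Nonempty := by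
    rw [← Finset.card_pos]
    have := Finset.card_union_add_card_inter (reachSet F {u}) (reachSet F {v})
    have := Finset.card_le_univ (reachSet F {u} ∪ reachSet F {v})
    omega
  simp only [mem_inter, mem_reachSet, mem_singleton, exists_eq_left] at hy
  obtain ⟨p⟩ := hy.1.trans hy.2.symm
  exact induce_reachable_of_walk p hu hv

end LargeComponent

/-! ### Edge expansion from the spectral gap -/

section Expansion

open Matrix

variable {V : Type*} [Fintype V] [DecidableEq V]

/-- A vector orthogonal to a suitable eigenvector for the largest eigenvalue has Rayleigh quotient
at most the second-largest eigenvalue. -/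
theorem exists_dotProduct_mulVec_le {A : Matrix V V ℝ} (hA : A.IsHermitian)
    (hV : 2 ≤ Fintype.card V) : ∃ z : V → ℝ, ∀ y : V → ℝ, z ⬝ᵥ y = 0 →
      y ⬝ᵥ (A *ᵥ y) ≤ hA.eigenvalues₀ ⟨1, hV⟩ * (y ⬝ᵥ y) := by
  set b := hA.eigenvectorBasis with hb
  let φ : Fin (Fintype.card V) ≃ V := Fintype.equivOfCardEq (Fintype.card_fin _)
  have hφ : ∀ i, hA.eigenvalues (φ i) = hA.eigenvalues₀ i := fun i => by
    simp [Matrix.IsHermitian.eigenvalues, φ]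
  set i₀ : V := φ ⟨0, by omega⟩ with hi₀
  have hin : ∀ u v : EuclideanSpace ℝ V, inner ℝ u v = u.ofLp ⬝ᵥ v.ofLp := fun u v => by
    rw [EuclideanSpace.inner_eq_star_dotProduct, dotProduct_comm]; simp
  have parseval : ∀ u v : V → ℝ, u ⬝ᵥ v = ∑ i, (u ⬝ᵥ (b i).ofLp) * ((b i).ofLp ⬝ᵥ v) :=
    fun u v => by
    have := b.sum_inner_mul_inner (WithLp.toLp 2 u) (WithLp.toLp 2 v)
    simp only [hin] at this
    exact this.symm
  have hsymm : ∀ u v : V → ℝ, u ⬝ᵥ (A *ᵥ v) = (A *ᵥ u) ⬝ᵥ v := fun u v => by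
    have hT : Aᵀ = A := by
      rw [← Matrix.conjTranspose_eq_transpose_of_trivial]; exact hA
    rw [dotProduct_mulVec, ← mulVec_transpose, hT]
  refine ⟨(b i₀).ofLp, fun y hy => ?_⟩
  rw [parseval y (A *ᵥ y), parseval y y, Finset.mul_sum]
  refine Finset.sum_le_sum fun i _ => ?_
  rw [hsymm, hb, hA.mulVec_eigenvectorBasis, ← hb, smul_dotProduct, dotProduct_comm y, smul_eq_mul]
  by_cases hi : i = i₀
  · rw [hi, hy]; simp
  · obtain ⟨j, rfl⟩ := φ.surjective i
    have hj : (⟨1, hV⟩ : Fin (Fintype.card V)) ≤ j := by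
      rw [Fin.le_def]
      have : j ≠ ⟨0, by omega⟩ := fun h => hi (by rw [h])
      have : (j : ℕ) ≠ 0 := fun h => this (Fin.ext h)
      change 1 ≤ (j : ℕ)
      omega
    rw [hφ]
    have h1 := hA.eigenvalues₀_antitone hj
    nlinarith [mul_self_nonneg ((b (φ j)).ofLp ⬝ᵥ y)]

/-- If the all-ones vector is an eigenvector whose eigenvalue exceeds the second-largest one, the
vectors orthogonal to it have Rayleigh quotient at most the second-largest eigenvalue. -/
theorem dotProduct_mulVec_le_of_sum_eq_zero {A : Matrix V V ℝ} (hA : A.IsHermitian)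
    (hV : 2 ≤ Fintype.card V) {D : ℝ} (hD : A *ᵥ 1 = D • (1 : V → ℝ))
    (hlt : hA.eigenvalues₀ ⟨1, hV⟩ < D) {x : V → ℝ} (hx : (1 : V → ℝ) ⬝ᵥ x = 0) :
    x ⬝ᵥ (A *ᵥ x) ≤ hA.eigenvalues₀ ⟨1, hV⟩ * (x ⬝ᵥ x) := by
  obtain ⟨z, hz⟩ := exists_dotProduct_mulVec_le hA hV
  set l := hA.eigenvalues₀ ⟨1, hV⟩
  have hT : Aᵀ = A := by
    rw [← Matrix.conjTranspose_eq_transpose_of_trivial]; exact hA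
  have hcard : (0 : ℝ) < Fintype.card V := by
    have : 0 < Fintype.card V := by omega
    exact_mod_cast this
  have h11 : (1 : V → ℝ) ⬝ᵥ 1 = Fintype.card V := by simp
  have hx' : x ⬝ᵥ (1 : V → ℝ) = 0 := by rw [dotProduct_comm]; exact hx
  have h1Ax : (1 : V → ℝ) ⬝ᵥ (A *ᵥ x) = 0 := by
    rw [dotProduct_mulVec, ← mulVec_transpose, hT, hD, smul_dotProduct, hx, smul_zero]
  -- The top eigenvector `z` need not be known to be constant. If the claim failed, the form of `A -
  -- l` would be positive definite on the span of `1` and `x`, which contains a nonzero vector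
  -- orthogonal to `z`.
  have hgen : ∀ s t : ℝ, z ⬝ᵥ (s • (1 : V → ℝ) + t • x) = 0 →
      s ^ 2 * (D - l) * Fintype.card V + t ^ 2 * (x ⬝ᵥ (A *ᵥ x) - l * (x ⬝ᵥ x)) ≤ 0 := by
    intro s t hst
    have := hz _ hst
    simp only [mulVec_add, mulVec_smul, hD, dotProduct_add, add_dotProduct, smul_dotProduct,
      dotProduct_smul, hx, hx', h1Ax, h11, smul_eq_mul] at this
    linarith
  by_contra! hcon
  have hd : 0 < x ⬝ᵥ (A *ᵥ x) - l * (x ⬝ᵥ x) := by linarith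
  have hDl : 0 < (D - l) * Fintype.card V := mul_pos (by linarith) hcard
  by_cases h1 : z ⬝ᵥ (1 : V → ℝ) = 0
  · have := hgen 1 0 (by simpa using h1)
    nlinarith
  · have := hgen (z ⬝ᵥ x) (-(z ⬝ᵥ 1)) (by
      simp only [dotProduct_add, dotProduct_smul, smul_eq_mul]; ring)
    have h2 : 0 < (z ⬝ᵥ (1 : V → ℝ)) ^ 2 := by positivity
    nlinarith [mul_pos h2 hd, mul_nonneg (sq_nonneg (z ⬝ᵥ x)) hDl.le]

theorem card_mul_degree_le {G : SimpleGraph V} [DecidableRel G.Adj] {D : ℕ}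
    (hG : G.IsRegularOfDegree D) (S : Finset V) :
    S.card * D ≤ (∑ a ∈ S, (S.filter (G.Adj a)).card) + (boundary G.edgeFinset S).card := by
  have hsplit : ∀ a, D = (S.filter (G.Adj a)).card + (Sᶜ.filter (G.Adj a)).card := fun a => by
    rw [← hG a, ← G.card_neighborFinset_eq_degree, G.neighborFinset_eq_filter,
      ← Finset.card_union_of_disjoint, ← Finset.filter_union, Finset.union_compl]
    exact Finset.disjoint_filter_filter disjoint_compl_right
  calc S.card * D = ∑ a ∈ S, D := by simp
    _ = (∑ a ∈ S, (S.filter (G.Adj a)).card) + ∑ a ∈ S, (Sᶜ.filter (G.Adj a)).card := by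
      rw [← Finset.sum_add_distrib]; exact Finset.sum_congr rfl fun a _ => hsplit a
    _ ≤ _ := by
      refine Nat.add_le_add_left ?_ _
      rw [← Finset.card_sigma]
      -- Injective because the endpoint in `S` fixes the orientation of a boundary edge.
      refine Finset.card_le_card_of_injOn (fun y : (_ : V) × V => s(y.1, y.2)) ?_ ?_
      · rintro ⟨a, b⟩ h
        simp only [coe_sigma, Set.mem_sigma_iff, mem_coe, mem_filter, mem_compl] at h
        simp only [boundary, mem_coe, mem_filter, SimpleGraph.mem_edgeFinset,
          SimpleGraph.mem_edgeSet]
        exact ⟨h.2.2, a, h.1, b, h.2.1, rfl⟩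
      · rintro ⟨a, b⟩ h ⟨a', b'⟩ h' heq
        simp only [coe_sigma, Set.mem_sigma_iff, mem_coe, mem_filter, mem_compl] at h h'
        simp only [Sym2.eq_iff] at heq
        rcases heq with ⟨rfl, rfl⟩ | ⟨rfl, rfl⟩
        · rfl
        · exact absurd h.1 h'.2.1

/-- Edge expansion of a regular graph from its spectral gap. -/
theorem spectral_gap_mul_le_card_boundary {G : SimpleGraph V} [DecidableRel G.Adj]
    (hV : 2 ≤ Fintype.card V) {D : ℕ} (hG : G.IsRegularOfDegree D)
    (hlt : secondEigenvalue G hV < D) (S : Finset V) :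
    (D - secondEigenvalue G hV) * S.card * (Fintype.card V - S.card) ≤
      Fintype.card V * (boundary G.edgeFinset S).card := by
  set l := secondEigenvalue G hV with hl
  set n : ℝ := (Fintype.card V : ℝ) with hn
  have hn0 : 0 < n := by
    have : 0 < Fintype.card V := by omega
    rw [hn]; exact_mod_cast this
  set A := G.adjMatrix ℝ with hAdef
  have hT : Aᵀ = A := G.isSymm_adjMatrix
  have hD : A *ᵥ 1 = (D : ℝ) • (1 : V → ℝ) := by
    ext v
    have := SimpleGraph.adjMatrix_mulVec_const_apply_of_regular (G := G) (a := (1 : ℝ)) hG (v := v)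
    change (G.adjMatrix ℝ *ᵥ Function.const V 1) v = _
    rw [this]; simp
  set f : V → ℝ := fun v => if v ∈ S then 1 else 0 with hf
  set k : ℝ := (S.card : ℝ) with hk
  have h11 : (1 : V → ℝ) ⬝ᵥ 1 = n := by simp [hn]
  have h1f : (1 : V → ℝ) ⬝ᵥ f = k := by simp [dotProduct, hf, hk]
  have hf1 : f ⬝ᵥ (1 : V → ℝ) = k := by rw [dotProduct_comm, h1f]
  have hff : f ⬝ᵥ f = k := by simp [dotProduct, hf, hk]
  have h1Af : (1 : V → ℝ) ⬝ᵥ (A *ᵥ f) = D * k := by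
    rw [dotProduct_mulVec, ← mulVec_transpose, hT, hD, smul_dotProduct, h1f, smul_eq_mul]
  have hfAf : f ⬝ᵥ (A *ᵥ f) = ((∑ a ∈ S, (S.filter (G.Adj a)).card : ℕ) : ℝ) := by
    simp [dotProduct, mulVec, hf, hAdef, SimpleGraph.adjMatrix_apply]
  have hcount : k * D ≤ f ⬝ᵥ (A *ᵥ f) + (boundary G.edgeFinset S).card := by
    rw [hfAf, hk]; exact_mod_cast card_mul_degree_le hG S
  -- The indicator of `S` projected off the constants, scaled by `n` to avoid division.
  have hx : (1 : V → ℝ) ⬝ᵥ (n • f - k • (1 : V → ℝ)) = 0 := by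
    rw [dotProduct_sub, dotProduct_smul, dotProduct_smul, h1f, h11]; simp [mul_comm]
  have := dotProduct_mulVec_le_of_sum_eq_zero (adjMatrix_isHermitian G) hV hD hlt hx
  simp only [mulVec_sub, mulVec_smul, hD, dotProduct_sub, sub_dotProduct, smul_dotProduct,
    dotProduct_smul, h1f, hf1, hff, h1Af, h11, smul_eq_mul, ← hAdef] at this
  change _ ≤ l * _ at this
  have h2 : n * (n * (f ⬝ᵥ (A *ᵥ f)) - D * k ^ 2) ≤ n * (l * k * (n - k)) := by
    linarith
  have h3 := le_of_mul_le_mul_left h2 hn0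
  nlinarith [mul_le_mul_of_nonneg_left hcount hn0.le]

theorem mul_card_lt_card_boundary {G : SimpleGraph V} [DecidableRel G.Adj]
    (hV : 2 ≤ Fintype.card V) {D d : ℕ} {c : ℝ} (hG : G.IsRegularOfDegree D)
    (hgap : secondEigenvalue G hV ≤ D * (1 - c)) (hd : (d : ℝ) < c * D / 2)
    {S : Finset V} (hS : S.Nonempty) (hcard : 2 * S.card ≤ Fintype.card V) :
    d * S.card < (boundary G.edgeFinset S).card := by
  have hcD : 0 < c * D := by linarith [(Nat.cast_nonneg d : (0 : ℝ) ≤ d)]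
  have h := spectral_gap_mul_le_card_boundary hV hG (by linarith) S
  have hS0 : (0 : ℝ) < S.card := by exact_mod_cast hS.card_pos
  have hle : (2 : ℝ) * S.card ≤ Fintype.card V := by exact_mod_cast hcard
  have h1 : c * D * S.card * (Fintype.card V / 2) ≤
      Fintype.card V * (boundary G.edgeFinset S).card := by
    refine le_trans ?_ h
    have hg : c * D ≤ D - secondEigenvalue G hV := by linarith
    have : 0 ≤ D - secondEigenvalue G hV := by linarith
    gcongr
    linarith
  have hn : (0 : ℝ) < Fintype.card V := by linarith
  have h2 : c * D / 2 * S.card ≤ (boundary G.edgeFinset S).card := by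
    refine le_of_mul_le_mul_left (le_trans (le_of_eq ?_) h1) hn
    ring
  have h3 : (d : ℝ) * S.card < (boundary G.edgeFinset S).card :=
    (mul_lt_mul_of_pos_right hd hS0).trans_le h2
  exact_mod_cast h3

end Expansion

/-! ### Success probability and number of tests -/

section Main

variable {V : Type*} [Fintype V] [DecidableEq V]

/-- The root of `1 / 2` of order `d`, and a lower bound for its distance to `1`. -/
theorem exists_pow_eq_half {d : ℕ} (hd : 1 ≤ d) :
    ∃ x : ℝ, 0 < x ∧ x ≤ 1 ∧ x ^ d = 1 / 2 ∧ 3 / (4 * d) ≤ 1 - x ^ 2 := by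
  have hd0 : (0 : ℝ) < d := by exact_mod_cast hd
  have hd1 : (1 : ℝ) ≤ d := by exact_mod_cast hd
  refine ⟨(1 / 2 : ℝ) ^ ((d : ℝ)⁻¹), by positivity, ?_, ?_, ?_⟩
  · exact Real.rpow_le_one (by norm_num) (by norm_num) (by positivity)
  · exact Real.rpow_inv_natCast_pow (by norm_num) (by omega)
  · set x := (1 / 2 : ℝ) ^ ((d : ℝ)⁻¹) with hx
    have hxd : x ^ d = 1 / 2 := Real.rpow_inv_natCast_pow (by norm_num) (by omega)
    -- Bernoulli gives `(1 - 3 / (4 * d)) ^ d ≥ 1 / 4 = (x ^ 2) ^ d`.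
    have hbern := one_add_mul_le_pow (a := -(3 / (4 * (d : ℝ))))
      (by
        have : 3 / (4 * (d : ℝ)) ≤ 2 := by rw [div_le_iff₀ (by positivity)]; linarith
        linarith) d
    have h1 : 1 + (d : ℝ) * -(3 / (4 * d)) = 1 / 4 := by field_simp; norm_num
    have h2 : (x ^ 2) ^ d = 1 / 4 := by rw [← pow_mul, mul_comm, pow_mul, hxd]; norm_num
    have h3 : (0 : ℝ) ≤ 1 + -(3 / (4 * d)) := by
      have : 3 / (4 * (d : ℝ)) ≤ 1 := by rw [div_le_iff₀ (by positivity)]; linarith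
      linarith
    have h4 : x ^ 2 ≤ 1 + -(3 / (4 * d)) := by
      refine le_of_pow_le_pow_left₀ (n := d) (by omega) h3 ?_
      rw [h2, ← h1]; exact hbern
    linarith

/-- In an expanding graph the large component of a random edge set contains a given edge and avoids
`d` given edges with probability of order at least `1 / d`. -/
theorem le_subsetProb_mem_largeComponent {G : SimpleGraph V} [DecidableRel G.Adj] {d : ℕ}
    (hexp : ∀ S : Finset V, S.Nonempty → 2 * S.card ≤ Fintype.card V →
      d * S.card < (boundary G.edgeFinset S).card)
    {x : ℝ} (hx0 : 0 < x) (hx1 : x ≤ 1) (hxd : x ^ d = 1 / 2)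
    {e : Sym2 V} (he : e ∈ G.edgeFinset) {B : Finset (Sym2 V)} (hB : B ⊆ G.edgeFinset)
    (hBd : B.card = d) (heB : e ∉ B) :
    (1 - x ^ 2) / 8 ≤ subsetProb (x ^ 2) G.edgeFinset
      (fun F => e ∈ largeComponent F ∧ Disjoint B (largeComponent F)) := by
  have hq0 : 0 ≤ x ^ 2 := by positivity
  have hq1 : x ^ 2 ≤ 1 := pow_le_one₀ hx0.le hx1
  induction e using Sym2.ind with
  | _ u v =>
  have huv : u ≠ v := by
    rw [SimpleGraph.mem_edgeFinset, SimpleGraph.mem_edgeSet] at he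
    exact he.ne
  set U := (G.edgeFinset \ B).erase s(u, v) with hU
  have hsmall := subsetProb_small_reachSet_le hx0 hx1 hxd (G.edgeFinset \ B) {u, v}
    (by
      intro S hS hcard
      have h1 := hexp S ⟨u, hS (by simp)⟩ hcard
      have h2 : boundary G.edgeFinset S ⊆ boundary (G.edgeFinset \ B) S ∪ B := by
        intro f hf
        simp only [boundary, mem_filter, mem_union, mem_sdiff] at hf ⊢
        by_cases hfB : f ∈ B
        · exact Or.inr hfB
        · exact Or.inl ⟨⟨hf.1, hfB⟩, hf.2⟩
      have h3 := (Finset.card_le_card h2).trans (Finset.card_union_le _ _)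
      omega)
    U ∅ {u, v} subset_rfl
    (by
      rintro f hf ⟨b, hbf, hb⟩
      rw [Finset.union_empty, hU, Finset.mem_erase]
      refine ⟨?_, hf⟩
      rintro rfl
      exact hb (by simpa using hbf))
  rw [Finset.card_pair huv, Finset.card_empty, pow_zero, mul_one, pow_mul, hxd] at hsmall
  have hnot := subsetProb_add_not (x ^ 2) U
    (fun F => 2 * (reachSet F {u, v}).card ≤ Fintype.card V)
  have hmono := subsetProb_mono hq0 hq1 U
    (P := fun F => ¬ 2 * (reachSet F {u, v}).card ≤ Fintype.card V)
    (Q := fun F => s(u, v) ∈ largeComponent (insert s(u, v) F) ∧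
      Disjoint B (largeComponent (insert s(u, v) F)))
    (by
      intro F hF hlarge
      constructor
      · simp only [largeComponent, mem_filter]
        refine ⟨by simp, u, by simp, ?_⟩
        have hsub := reachSet_insert_vertex_subset F (S := {u}) (by simp) huv
        rw [Finset.pair_comm] at hlarge
        have := Finset.card_le_card hsub
        omega
      · refine Finset.disjoint_of_subset_right (largeComponent_subset _) ?_
        rw [Finset.disjoint_left]
        intro f hfB hf
        rcases Finset.mem_insert.1 hf with rfl | hf
        · exact heB hfB
        · have := hF hf
          simp [hU, hfB] at this)
  have hcond := conditioned_subsetProb_le hq0 hq1 he hB heB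
    (fun F => s(u, v) ∈ largeComponent F ∧ Disjoint B (largeComponent F))
  refine le_trans ?_ hcond
  have hqd : (x ^ 2) ^ B.card = 1 / 4 := by
    rw [hBd, ← pow_mul, mul_comm, pow_mul, hxd]; norm_num
  rw [hqd, div_eq_mul_inv]
  refine mul_le_mul_of_nonneg_left ?_ (by linarith)
  linarith

/-- The number of tests used is of order `d ^ 2 * log m`. -/
theorem exists_nat_le_and_pow_mul_lt_one {d m : ℕ} (hd : 1 ≤ d) (hm : 2 ≤ m) {r : ℝ}
    (hr : 3 / (32 * d) ≤ r) (hr1 : r ≤ 1) :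
    ∃ N : ℕ, (N : ℝ) ≤ 30 * (d : ℝ) ^ 2 * Real.log m ∧ (1 - r) ^ N * (m : ℝ) ^ (d + 1) < 1 := by
  have hd1 : (1 : ℝ) ≤ d := by exact_mod_cast hd
  have hm2 : (2 : ℝ) ≤ m := by exact_mod_cast hm
  have hlog : 0.69 ≤ Real.log m := by
    have := Real.log_le_log (by norm_num) hm2
    linarith [Real.log_two_gt_d9]
  set L := Real.log m with hL
  -- Chosen so that `3 / (32 * d) * y = 2 * d * L ≥ (d + 1) * L`; since `L ≥ 0.69`, rounding up
  -- still fits below `30 * d ^ 2 * L`.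
  set y := 64 / 3 * (d : ℝ) ^ 2 * L with hy
  have hd2 : (1 : ℝ) ≤ (d : ℝ) ^ 2 := one_le_pow₀ hd1
  have hy0 : 0 ≤ y := by positivity
  refine ⟨⌊y⌋₊ + 1, ?_, ?_⟩
  · have := Nat.floor_le hy0
    push_cast
    nlinarith
  · have hyN : y < ((⌊y⌋₊ + 1 : ℕ) : ℝ) := by push_cast; exact Nat.lt_floor_add_one y
    set N := ⌊y⌋₊ + 1
    have h1 : (1 - r) ^ N ≤ Real.exp (-(r * N)) := by
      calc (1 - r) ^ N ≤ Real.exp (-r) ^ N :=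
            pow_le_pow_left₀ (by linarith) (Real.one_sub_le_exp_neg r) N
        _ = Real.exp (-(r * N)) := by rw [← Real.exp_nat_mul]; ring_nf
    have h2 : (m : ℝ) ^ (d + 1) = Real.exp ((d + 1 : ℕ) * L) := by
      rw [Real.exp_nat_mul, hL, Real.exp_log (by linarith)]
    have h3 : (d + 1 : ℕ) * L < r * N := by
      have h4 : 3 / (32 * (d : ℝ)) * y = 2 * d * L := by rw [hy]; field_simp; norm_num
      have h5 : 3 / (32 * (d : ℝ)) * y < 3 / (32 * (d : ℝ)) * N :=
        mul_lt_mul_of_pos_left hyN (by positivity)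
      have h6 : 3 / (32 * (d : ℝ)) * N ≤ r * N :=
        mul_le_mul_of_nonneg_right hr (Nat.cast_nonneg _)
      push_cast
      nlinarith
    calc (1 - r) ^ N * (m : ℝ) ^ (d + 1)
        ≤ Real.exp (-(r * N)) * Real.exp ((d + 1 : ℕ) * L) := by rw [h2]; gcongr
      _ = Real.exp (-(r * N) + (d + 1 : ℕ) * L) := (Real.exp_add _ _).symm
      _ < 1 := by rw [Real.exp_lt_one_iff]; linarith

/-- Connected `d`-disjunct tests in a graph in which sets of at most half of the vertices expand. -/
theorem exists_isDisjunct_of_expansion {G : SimpleGraph V} [DecidableRel G.Adj] {d : ℕ}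
    (hV : 2 ≤ Fintype.card V) (hd : 1 ≤ d)
    (hexp : ∀ S : Finset V, S.Nonempty → 2 * S.card ≤ Fintype.card V →
      d * S.card < (boundary G.edgeFinset S).card) :
    ∃ 𝒯 : Finset (Finset (Sym2 V)), (∀ T ∈ 𝒯, IsConnectedTest G T) ∧
      IsDisjunct G.edgeFinset d 𝒯 ∧
      (𝒯.card : ℝ) ≤ 30 * (d : ℝ) ^ 2 * Real.log (G.edgeFinset.card : ℝ) := by
  classical
  set E := G.edgeFinset with hE
  -- Used for `2 ≤ m`, and to enlarge a smaller `B` to exactly `d` edges avoiding `e`.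
  have hm : d < E.card := by
    obtain ⟨u⟩ : Nonempty V := Fintype.card_pos_iff.1 (by omega)
    have h1 := hexp {u} (by simp) (by simpa using hV)
    have h2 : (boundary E {u}).card ≤ E.card := Finset.card_le_card (Finset.filter_subset _ _)
    rw [Finset.card_singleton, mul_one] at h1
    omega
  obtain ⟨x, hx0, hx1, hxd, hx⟩ := exists_pow_eq_half hd
  have hq0 : 0 ≤ x ^ 2 := by positivity
  have hq1 : x ^ 2 ≤ 1 := pow_le_one₀ hx0.le hx1
  have hr : 3 / (32 * (d : ℝ)) ≤ (1 - x ^ 2) / 8 := by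
    have : 3 / (32 * (d : ℝ)) = 3 / (4 * d) / 8 := by
      rw [div_div]; ring_nf
    rw [this]
    linarith
  have hr1 : (1 - x ^ 2) / 8 ≤ 1 := by linarith
  obtain ⟨N, hN, hN1⟩ := exists_nat_le_and_pow_mul_lt_one hd (by omega : 2 ≤ E.card) hr hr1
  set X := (E ×ˢ E.powersetCard d).filter fun y => y.1 ∉ y.2 with hX
  have hXcard : (X.card : ℝ) ≤ (E.card : ℝ) ^ (d + 1) := by
    have h1 : X.card ≤ E.card * E.card.choose d := by
      refine (Finset.card_filter_le _ _).trans ?_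
      rw [Finset.card_product, Finset.card_powersetCard]
    have h2 : X.card ≤ E.card ^ (d + 1) := by
      rw [pow_succ']
      exact h1.trans (Nat.mul_le_mul_left _ (Nat.choose_le_pow _ _))
    exact_mod_cast h2
  obtain ⟨𝒜, h𝒜, h𝒜card, hun⟩ := exists_greedy_cover hq0 hq1 hr1 E X
    (fun F y => y.1 ∈ largeComponent F ∧ Disjoint y.2 (largeComponent F))
    (by
      rintro ⟨e, B⟩ hy
      simp only [hX, mem_filter, mem_product, mem_powersetCard] at hy
      exact le_subsetProb_mem_largeComponent hexp hx0 hx1 hxd hy.1.1 hy.1.2.1 hy.1.2.2 hy.2) N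
  -- Outcomes without a large component give the empty set, which is not a connected test; dropping
  -- it loses nothing, as a useful test contains `e`.
  refine ⟨(𝒜.image largeComponent).filter Finset.Nonempty, ?_, ?_, ?_⟩
  · intro T hT
    simp only [mem_filter, mem_image] at hT
    obtain ⟨⟨F, hF, rfl⟩, hne⟩ := hT
    refine isConnectedTest_largeComponent (fun f hf => ?_) hne
    exact SimpleGraph.mem_edgeFinset.1 (Finset.mem_powerset.1 (h𝒜 hF) hf)
  · intro e he B hB hBd heB
    obtain ⟨B', hBB', hB'E, hB'd⟩ := Finset.exists_subsuperset_card_eq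
      (s := B) (t := E.erase e) (n := d)
      (fun f hf => Finset.mem_erase.2 ⟨fun h => heB (h ▸ hf), hB hf⟩) hBd
      (by rw [Finset.card_erase_of_mem he]; omega)
    have hmem : (e, B') ∈ X := by
      simp only [hX, mem_filter, mem_product, mem_powersetCard]
      exact ⟨⟨he, hB'E.trans (Finset.erase_subset _ _), hB'd⟩,
        fun h => Finset.notMem_erase e E (hB'E h)⟩
    by_contra! hcon
    have hpos : 0 < (X.filter fun y => ∀ F ∈ 𝒜,
        ¬ (y.1 ∈ largeComponent F ∧ Disjoint y.2 (largeComponent F))).card := by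
      refine Finset.card_pos.2 ⟨(e, B'), Finset.mem_filter.2 ⟨hmem, fun F hF h => ?_⟩⟩
      exact hcon (largeComponent F)
        (Finset.mem_filter.2 ⟨Finset.mem_image_of_mem _ hF, ⟨e, h.1⟩⟩) h.1
        (Finset.disjoint_of_subset_left hBB' h.2)
    have h1 : (1 - (1 - x ^ 2) / 8) ^ N * (X.card : ℝ) ≤
        (1 - (1 - x ^ 2) / 8) ^ N * (E.card : ℝ) ^ (d + 1) :=
      mul_le_mul_of_nonneg_left hXcard (pow_nonneg (by linarith) _)
    have h2 := (hun.trans h1).trans_lt hN1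
    rw [Nat.cast_lt_one] at h2
    exact hpos.ne' (by convert h2)
  · refine le_trans ?_ hN
    exact_mod_cast ((Finset.card_filter_le _ _).trans Finset.card_image_le).trans h𝒜card

end Main

end GraphGroupTesting

theorem mainTheorem3 :
    ∃ C : ℝ, 0 < C ∧
      ∀ (V : Type*) [Fintype V] [DecidableEq V] (G : SimpleGraph V) [DecidableRel G.Adj]
        (hV : 2 ≤ Fintype.card V) (D : ℕ) (c : ℝ),
        G.IsRegularOfDegree D → 0 < c →
        GraphGroupTesting.secondEigenvalue G hV ≤ D * (1 - c) →
        ∀ d : ℕ, 1 ≤ d → (d : ℝ) < c * D / 2 →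
          ∃ 𝒯 : Finset (Finset (Sym2 V)),
            (∀ T ∈ 𝒯, GraphGroupTesting.IsConnectedTest G T) ∧
            GraphGroupTesting.IsDisjunct G.edgeFinset d 𝒯 ∧
            (𝒯.card : ℝ) ≤ C * (d : ℝ) ^ 2 * Real.log (G.edgeFinset.card : ℝ) := by
  refine ⟨30, by norm_num, ?_⟩
  intro V _ _ G _ hV D c hG _ hgap d hd1 hd
  exact GraphGroupTesting.exists_isDisjunct_of_expansion hV hd1 fun S hS hcard =>
    GraphGroupTesting.mul_card_lt_card_boundary hV hG hgap hd hS hcard
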